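/- Let $K$ be an infinite field with algebraic closure $\overline K$, let $d, m, n_1,\dots,n_d \ge 0$ be integers, and put $N = n_1+\cdots+n_d$. Let $f_1,\dots,f_m : K^{n_1}\times\cdots\times K^{n_d}\to K$ be functions of multidegree $\le (1,\dots,1)$; that is, for each $j\in\{1,\dots,m\}$ and each $i\in\{1,\dots,d\}$ there is $e\in\{0,1\}$ such that, for all fixed values of the other arguments, $f_j$ is a homogeneous polynomial of degree $e$ in its $i$-th argument (the zero polynomial being homogeneous of every degree). Let \[ Z(K)=\{\mathsf v\in K^{n_1}\times\cdots\times K^{n_d} : f_1(\mathsf v)=\cdots=f_m(\mathsf v)=0\}\subseteq K^N, \] and let \[ \overline{Z(K)}=\{w\in\overline K^{N} : g(w)=0 \text{ for all } g\in K[x_1,\dots,x_N] \text{ vanishing on } Z(K)\} \] be its Zariski closure in $\overline K^{N}$. Then every irreducible component $W$ of $\overline{Z(K)}$ (with respect to the Zariski topology of $\overline K^N$) satisfies $\operatorname{codim} W\le 2^d m$, where $\operatorname{codim} W$ is the codimension of $W$ in $\overline K^N$, i.e. the supremum of the lengths $r$ of chains $W=C_0\subsetneq C_1\subsetneq\cdots\subsetneq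 C_r\subseteq\overline K^N$ of irreducible closed sets. -/

import Mathlib

noncomputable section

/-- `f : K^{n_1} × ⋯ × K^{n_d} → K` satisfies `deg_j f = e`: for every choice of the other
arguments, `f` is a homogeneous polynomial of degree `e` in the `j`-th argument
(the zero polynomial being homogeneous of every degree). -/
def HasPartialDegree {K : Type*} [Field K] {d : ℕ} {n : Fin d → ℕ}
    (f : (∀ i, Fin (n i) → K) → K) (j : Fin d) (e : ℕ) : Prop :=
  ∀ v : ∀ i, Fin (n i) → K, ∃ p : MvPolynomial (Fin (n j)) K,
    p.IsHomogeneous e ∧ ∀ x : Fin (n j) → K, f (Function.update v j x) = MvPolynomial.eval x p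

/-- `mdeg f ≤ (e_1, …, e_d)`. -/
def MultidegreeLE {K : Type*} [Field K] {d : ℕ} {n : Fin d → ℕ}
    (f : (∀ i, Fin (n i) → K) → K) (e : Fin d → ℕ) : Prop :=
  ∀ j, ∃ e' ≤ e j, HasPartialDegree f j e'

/-- The set `Z_{f_1,…,f_m}(K)` of common zeros of `f_1, …, f_m` in
`K^{n_1} × ⋯ × K^{n_d}`, the latter being identified with the affine space with
coordinates indexed by the pairs `⟨i, k⟩`, `k < n_i`. -/
def multilinearVariety {K : Type*} [Field K] {d m : ℕ} {n : Fin d → ℕ}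
    (f : Fin m → (∀ i, Fin (n i) → K) → K) : Set ((Σ i, Fin (n i)) → K) :=
  {x | ∀ j, f j (fun i k => x ⟨i, k⟩) = 0}

/-- The Zariski topology on `L^σ`: closed sets are the common zero sets of ideals of the
polynomial ring `L[x_s : s ∈ σ]`. -/
@[reducible] def zariskiTopology (σ L : Type*) [Field L] : TopologicalSpace (σ → L) :=
  TopologicalSpace.ofClosed
    {C : Set (σ → L) | ∃ I : Ideal (MvPolynomial σ L), C = MvPolynomial.zeroLocus L I}
    ⟨⊤, MvPolynomial.zeroLocus_top.symm⟩
    (by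
      intro A hA
      refine ⟨sSup {I | MvPolynomial.zeroLocus L I ∈ A}, ?_⟩
      apply Set.Subset.antisymm
      · intro x hx
        have h : sSup {I : Ideal (MvPolynomial σ L) | MvPolynomial.zeroLocus L I ∈ A} ≤
            MvPolynomial.vanishingIdeal L {x} := by
          refine sSup_le fun I hI p hp => ?_
          rw [MvPolynomial.mem_vanishingIdeal_singleton_iff]
          exact Set.mem_sInter.1 hx _ hI p hp
        intro p hp
        exact (MvPolynomial.mem_vanishingIdeal_singleton_iff x p).1 (h hp)
      · intro x hx C hC
        obtain ⟨I, rfl⟩ := hA hC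
        exact MvPolynomial.zeroLocus_anti_mono (le_sSup hC) hx)
    (by
      rintro _ ⟨I, rfl⟩ _ ⟨J, rfl⟩
      refine ⟨I * J, ?_⟩
      apply Set.Subset.antisymm
      · rintro x (hx | hx)
        · exact MvPolynomial.zeroLocus_anti_mono (Ideal.mul_le_left (I := I) (J := J)) hx
        · exact MvPolynomial.zeroLocus_anti_mono (Ideal.mul_le_right (I := I) (J := J)) hx
      · intro x hx
        by_contra h
        rw [Set.mem_union, not_or] at h
        simp only [MvPolynomial.mem_zeroLocus_iff, not_forall] at h
        obtain ⟨⟨p, hp, hpx⟩, ⟨q, hq, hqx⟩⟩ := h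
        have h0 := hx (p * q) (Ideal.mul_mem_mul hp hq)
        rw [map_mul] at h0
        exact (mul_ne_zero hpx hqx) h0)

/-- The affine space `L^σ`, equipped with the Zariski topology. -/
def ZariskiSpace (σ L : Type*) : Type _ := σ → L

instance ZariskiSpace.instTopologicalSpace (σ L : Type*) [Field L] :
    TopologicalSpace (ZariskiSpace σ L) :=
  zariskiTopology σ L

theorem ZariskiSpace.isClosed_iff {σ L : Type*} [Field L] {C : Set (ZariskiSpace σ L)} :
    IsClosed C ↔ ∃ I : Ideal (MvPolynomial σ L), C = MvPolynomial.zeroLocus L I := by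
  rw [← isOpen_compl_iff]
  change Cᶜᶜ ∈ _ ↔ _
  rw [compl_compl]
  rfl

/-- The Zariski closure of a set `S ⊆ K^σ` of `K`-rational points in the affine space over the
algebraic closure of `K`: the common zeros of all `g ∈ K[x_s : s ∈ σ]` that vanish on `S`. -/
def zariskiClosure {σ K : Type*} [Field K] (S : Set (σ → K)) :
    Set (ZariskiSpace σ (AlgebraicClosure K)) :=
  MvPolynomial.zeroLocus (AlgebraicClosure K) (MvPolynomial.vanishingIdeal K S)

/-- `W` is an irreducible component of the subset `Z`: a maximal irreducible subset of `Z`. -/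
def IsIrreducibleComponentOf {X : Type*} [TopologicalSpace X] (W Z : Set X) : Prop :=
  Maximal (fun s : Set X => IsIrreducible s ∧ s ⊆ Z) W

/-- The codimension of a closed set `W` in `X`: for `W` irreducible and closed, the supremum of
the lengths `r` of chains `W = C_0 ⊊ C_1 ⊊ ⋯ ⊊ C_r` of irreducible closed subsets of `X`, which
is the coheight of `W` among these (see `codim_coe`); in general, the minimum of
the codimensions of the irreducible closed subsets of `W`. -/
def codim {X : Type*} [TopologicalSpace X] (W : Set X) : ℕ∞ :=
  ⨅ (C : TopologicalSpace.IrreducibleCloseds X) (_ : (C : Set X) ⊆ W), Order.coheight C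

theorem codim_coe {X : Type*} [TopologicalSpace X] (C : TopologicalSpace.IrreducibleCloseds X) :
    codim (C : Set X) = Order.coheight C :=
  le_antisymm (iInf₂_le C Set.Subset.rfl)
    (le_iInf₂ fun D h => Order.coheight_anti (show D ≤ C from h))

end

/-! ### Heights of primes and codimension in affine space. -/

open MvPolynomial

/-! Rational points are dense in the closure, so each component `W` contains one, `a`, lying on no
other component. It suffices to find an irreducible set of codimension at most `d * m` through `a`
inside the closure: it must lie in `W` (`codim_irreducibleComponent_zariskiClosure_le`).

Such a set is the closure of the image of a polynomial map with value `a` at the origin, built one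
argument at a time (`IsDominantParam.exists_insert`). With the other arguments fixed, the equations
are `m` affine equations in the `j`-th argument, already solved by that of `a`. Adding solutions of
the linear system, with coefficients polynomial in the earlier parameters, frees all but at most `m`
of its `n j` coordinates. After `d` arguments at most `d * m` coordinates are lost, and
`height_le_card_compl` turns this count into a codimension bound. -/

theorem MvPolynomial.height_le_card_compl {σ L : Type*} [Fintype σ] [DecidableEq σ] [Field L]
    (Q : Ideal (MvPolynomial σ L)) [Q.IsPrime] (T : Finset σ)
    (hQ : ∀ p : MvPolynomial {x // x ∈ T} L, rename Subtype.val p ∈ Q → p = 0) :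
    Q.height ≤ (Tᶜ.card : ℕ) := by
  let e : {x // x ∉ T} ⊕ {x // x ∈ T} ≃ σ := (Equiv.sumComm _ _).trans (Equiv.sumCompl (· ∈ T))
  let E : MvPolynomial {x // x ∉ T} (MvPolynomial {x // x ∈ T} L) ≃ₐ[L] MvPolynomial σ L :=
    (sumAlgEquiv L _ _).symm.trans (renameEquiv L e)
  have hE : ∀ p : MvPolynomial {x // x ∈ T} L, E (C p) = rename Subtype.val p := by
    intro p
    have : (E.toAlgHom.toRingHom.comp (C : _ →+* MvPolynomial {x // x ∉ T} _)) =
        (rename Subtype.val : MvPolynomial {x // x ∈ T} L →ₐ[L] MvPolynomial σ L).toRingHom := by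
      ext x
      · simp [E]
      · simp [E, e]
    exact congr($this p)
  -- Inverting the nonzero polynomials in the `T`-variables keeps the height, as none of them lies
  -- in `Q`, and leaves a polynomial ring over a field in the remaining variables.
  let F := FractionRing (MvPolynomial {x // x ∈ T} L)
  let M := nonZeroDivisors (MvPolynomial {x // x ∈ T} L)
  let P := Q.comap E.toRingEquiv
  have hP : P.height = Q.height := RingEquiv.height_comap E.toRingEquiv Q
  have : P.IsPrime := Ideal.IsPrime.comap _
  let : Algebra (MvPolynomial {x // x ∉ T} (MvPolynomial {x // x ∈ T} L))
    (MvPolynomial {x // x ∉ T} F) := algebraMvPolynomial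
  have hloc : IsLocalization (M.map (C (σ := {x // x ∉ T}))) (MvPolynomial {x // x ∉ T} F) :=
    MvPolynomial.isLocalization M F
  have hdisj : Disjoint (↑(M.map (C (σ := {x // x ∉ T}))) :
      Set (MvPolynomial {x // x ∉ T} (MvPolynomial {x // x ∈ T} L))) ↑P := by
    rw [Set.disjoint_left]
    rintro _ ⟨p, hp, rfl⟩ hpP
    have h : E (C p) ∈ Q := hpP
    rw [hE] at h
    exact nonZeroDivisors.ne_zero hp (hQ p h)
  have hprime := IsLocalization.isPrime_of_isPrime_disjoint _
    (MvPolynomial {x // x ∉ T} F) P inferInstance hdisj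
  have hcomap := IsLocalization.under_map_of_isPrime_disjoint _
    (MvPolynomial {x // x ∉ T} F) (I := P) inferInstance hdisj
  have h1 := IsLocalization.height_under (M.map (C (σ := {x // x ∉ T})))
    (P.map (algebraMap _ (MvPolynomial {x // x ∉ T} F)))
  rw [hcomap] at h1
  rw [← hP, h1, ← WithBot.coe_le_coe]
  refine Ideal.height_le_ringKrullDim_of_isPrime.trans ?_
  rw [MvPolynomial.ringKrullDim_of_isNoetherianRing, ringKrullDim_eq_zero_of_field, zero_add]
  rw [Nat.card_eq_fintype_card, Fintype.card_subtype_compl, Fintype.card_coe, Finset.card_compl]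
  rfl

namespace ZariskiSpace

variable {σ L : Type*} [Field L]

theorem isClosed_zeroLocus (I : Ideal (MvPolynomial σ L)) :
    IsClosed (X := ZariskiSpace σ L) (zeroLocus L I) :=
  isClosed_iff.2 ⟨I, rfl⟩

theorem zeroLocus_vanishingIdeal_of_isClosed {C : Set (ZariskiSpace σ L)} (hC : IsClosed C) :
    zeroLocus L (vanishingIdeal L (C : Set (σ → L))) = C := by
  obtain ⟨I, rfl⟩ := isClosed_iff.1 hC
  exact zeroLocus_vanishingIdeal_galoisConnection.l_u_l_eq_l I

instance [Finite σ] : TopologicalSpace.NoetherianSpace (ZariskiSpace σ L) := by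
  refine ((TopologicalSpace.noetherianSpace_TFAE (ZariskiSpace σ L)).out 0 1).2 ?_
  refine ⟨(InvImage.wf (fun C : TopologicalSpace.Closeds (ZariskiSpace σ L) =>
    vanishingIdeal L (id (C : Set (ZariskiSpace σ L)) : Set (σ → L))) wellFounded_gt).mono ?_⟩
  intro C D h
  refine lt_of_le_of_ne (vanishingIdeal_anti_mono h.le) fun heq => h.ne ?_
  apply TopologicalSpace.Closeds.ext
  exact (zeroLocus_vanishingIdeal_of_isClosed C.isClosed).symm.trans <|
    (congrArg (zeroLocus L) heq.symm).trans <| zeroLocus_vanishingIdeal_of_isClosed D.isClosed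

theorem isPrime_vanishingIdeal {C : Set (ZariskiSpace σ L)} (hC : IsIrreducible C) :
    (vanishingIdeal L (C : Set (σ → L))).IsPrime := by
  refine Ideal.isPrime_iff.2 ⟨fun h => ?_, fun {p q} hpq => ?_⟩
  · obtain ⟨x, hx⟩ := hC.1
    have : (1 : MvPolynomial σ L) ∈ vanishingIdeal L (C : Set (σ → L)) := h ▸ Submodule.mem_top
    simpa using this x hx
  · have hcl : ∀ p : MvPolynomial σ L,
        IsClosed (X := ZariskiSpace σ L) {x : σ → L | aeval x p = 0} := fun p => by
      have h : {x : σ → L | aeval x p = 0} = zeroLocus L (Ideal.span {p}) := by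
        rw [zeroLocus_span]; simp
      exact h ▸ isClosed_zeroLocus (Ideal.span {p})
    refine (isPreirreducible_iff_isClosed_union_isClosed.1 hC.2 _ _ (hcl p) (hcl q) ?_)
    intro x hx
    have := hpq x hx
    rw [map_mul] at this
    exact mul_eq_zero.1 this

theorem isIrreducible_zeroLocus [IsAlgClosed L] [Finite σ] (Q : Ideal (MvPolynomial σ L))
    [hQ : Q.IsPrime] : IsIrreducible (X := ZariskiSpace σ L) (zeroLocus L Q) := by
  constructor
  · refine Set.nonempty_iff_ne_empty.2 fun h => ?_
    have := IsPrime.vanishingIdeal_zeroLocus (K := L) Q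
    rw [show zeroLocus L Q = (∅ : Set (σ → L)) from h, vanishingIdeal_empty] at this
    exact hQ.ne_top this.symm
  · refine isPreirreducible_iff_isClosed_union_isClosed.2 fun A B hA hB h => ?_
    obtain ⟨I, rfl⟩ := isClosed_iff.1 hA
    obtain ⟨J, rfl⟩ := isClosed_iff.1 hB
    have key : I * J ≤ Q := by
      rw [← IsPrime.vanishingIdeal_zeroLocus (K := L) Q, ← le_zeroLocus_iff_le_vanishingIdeal]
      intro x hx
      rcases h hx with hx | hx
      · exact zeroLocus_anti_mono Ideal.mul_le_left hx
      · exact zeroLocus_anti_mono Ideal.mul_le_right hx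
    rcases hQ.mul_le.1 key with h | h
    · exact .inl (zeroLocus_anti_mono h)
    · exact .inr (zeroLocus_anti_mono h)

/-- Vanishing ideals strictly reverse inclusions of closed sets, so a chain above the zero locus
gives a chain of primes below `Q`; the Nullstellensatz identifies its top with `Q`. -/
theorem codim_zeroLocus_le_height [IsAlgClosed L] [Finite σ] (Q : Ideal (MvPolynomial σ L))
    [hQ : Q.IsPrime] : codim (X := ZariskiSpace σ L) (zeroLocus L Q) ≤ Q.height := by
  let Y : TopologicalSpace.IrreducibleCloseds (ZariskiSpace σ L) :=
    ⟨zeroLocus L Q, isIrreducible_zeroLocus Q, isClosed_zeroLocus Q⟩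
  let g : (TopologicalSpace.IrreducibleCloseds (ZariskiSpace σ L))ᵒᵈ →
      PrimeSpectrum (MvPolynomial σ L) := fun C =>
    ⟨_, isPrime_vanishingIdeal (OrderDual.ofDual C).isIrreducible'⟩
  have hg : StrictMono g := by
    intro C D h
    refine lt_of_le_of_ne (vanishingIdeal_anti_mono (show (OrderDual.ofDual D) ≤ _ from h.le))
      fun heq => h.ne ?_
    apply OrderDual.ofDual.injective
    apply SetLike.coe_injective
    exact (zeroLocus_vanishingIdeal_of_isClosed (OrderDual.ofDual C).isClosed').symm.trans <|
      (congrArg (fun P => zeroLocus L P.asIdeal) heq).trans <|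
        zeroLocus_vanishingIdeal_of_isClosed (OrderDual.ofDual D).isClosed'
  have h := Order.height_le_height_apply_of_strictMono g hg (OrderDual.toDual Y)
  have h2 : (g (OrderDual.toDual Y)).asIdeal = Q := IsPrime.vanishingIdeal_zeroLocus (K := L) Q
  rw [← PrimeSpectrum.height_eq_orderHeight, h2] at h
  exact (codim_coe Y).trans_le h

end ZariskiSpace

/-! ### Closures of sets of rational points. -/

theorem isClosed_zariskiClosure {σ K : Type*} [Field K] (S : Set (σ → K)) :
    IsClosed (zariskiClosure S) := by
  refine ZariskiSpace.isClosed_iff.2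
    ⟨(vanishingIdeal K S).map (MvPolynomial.map (algebraMap K (AlgebraicClosure K))), ?_⟩
  have : ∀ x : σ → AlgebraicClosure K, x ∈ zeroLocus (AlgebraicClosure K) (vanishingIdeal K S) ↔
      x ∈ zeroLocus (AlgebraicClosure K) ((vanishingIdeal K S).map
        (MvPolynomial.map (algebraMap K (AlgebraicClosure K)))) := fun x => by
    rw [Ideal.map, zeroLocus_span]
    simp only [mem_zeroLocus_iff, Set.mem_ofPred_eq, Set.forall_mem_image, aeval_map_algebraMap]
    rfl
  exact Set.ext this

/-- A polynomial over an extension field vanishing on a set of rational points is a linear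
combination of polynomials over the base field vanishing on that set. -/
theorem aeval_eq_zero_of_mem_zariskiClosure {σ K : Type*} [Field K] {S : Set (σ → K)}
    {g : MvPolynomial σ (AlgebraicClosure K)}
    (hg : ∀ a ∈ S, aeval (fun x => algebraMap K (AlgebraicClosure K) (a x)) g = 0)
    {w : σ → AlgebraicClosure K} (hw : w ∈ zariskiClosure S) : aeval w g = 0 := by
  classical
  -- Expand the coefficients of `g` in a `K`-basis; at a rational point each coordinate polynomial
  -- `G i` must vanish separately.
  let b := Module.Basis.ofVectorSpace K (AlgebraicClosure K)
  let G : _ → MvPolynomial σ K := fun i =>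
    ∑ m ∈ g.support, monomial m (b.repr (g.coeff m) i)
  have hGmem : ∀ i, G i ∈ vanishingIdeal K S := by
    intro i a ha
    have h := congrArg (fun z => b.repr z i) (hg a ha)
    simp only [aeval_def, eval₂_eq, Algebra.algebraMap_self, RingHom.id_apply, ← map_pow,
      ← map_prod, mul_comm _ (algebraMap K _ _), ← Algebra.smul_def, map_sum, map_smul,
      Finsupp.coe_finsetSum, Finset.sum_apply, Finsupp.smul_apply, smul_eq_mul, map_zero,
      Finsupp.zero_apply] at h
    rw [← h]
    simp [G, aeval_monomial, Finsupp.prod, mul_comm]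
  let s := g.support.biUnion fun m => (b.repr (g.coeff m)).support
  have hs : ∀ m ∈ g.support, g.coeff m = ∑ i ∈ s, b.repr (g.coeff m) i • b i := by
    intro m hm
    conv_lhs => rw [← b.linearCombination_repr (g.coeff m), Finsupp.linearCombination_apply]
    exact Finsupp.sum_of_support_subset _ (Finset.subset_biUnion_of_mem
      (fun m => (b.repr (g.coeff m)).support) hm) _ (by simp)
  have hexp : aeval w g = ∑ i ∈ s, b i * aeval w (G i) := by
    simp only [G, map_sum, Finset.mul_sum]
    rw [Finset.sum_comm, aeval_def, eval₂_eq]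
    refine Finset.sum_congr rfl fun m hm => ?_
    rw [Algebra.algebraMap_self, RingHom.id_apply]
    conv_lhs => rw [hs m hm, Finset.sum_mul]
    refine Finset.sum_congr rfl fun i _ => ?_
    rw [aeval_monomial, Algebra.smul_def, Finsupp.prod]
    ring
  rw [hexp]
  exact Finset.sum_eq_zero fun i _ => by rw [hw _ (hGmem i), mul_zero]

theorem codim_irreducibleComponent_zariskiClosure_le {σ K : Type*} [Finite σ] [Field K]
    {S : Set (σ → K)} {W : Set (ZariskiSpace σ (AlgebraicClosure K))}
    (hW : IsIrreducibleComponentOf W (zariskiClosure S)) (c : ℕ∞)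
    (H : ∀ a ∈ S, ∃ Y : Set (ZariskiSpace σ (AlgebraicClosure K)), IsIrreducible Y ∧
      Y ⊆ zariskiClosure S ∧ (fun x => algebraMap K (AlgebraicClosure K) (a x)) ∈ Y ∧
      codim Y ≤ c) : codim W ≤ c := by
  obtain ⟨F, hFfin, hFcl, hFirr, hF⟩ :=
    TopologicalSpace.NoetherianSpace.exists_finite_set_isClosed_irreducible
      (isClosed_zariskiClosure S)
  have key : ∀ Y, IsIrreducible Y → ∀ F' ⊆ F, Y ⊆ ⋃₀ F' → ∃ C ∈ F', Y ⊆ C := by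
    intro Y hY F' hF' h
    exact isIrreducible_iff_sUnion_isClosed.1 hY (hFfin.subset hF').toFinset
      (by simpa using fun z hz => hFcl z (hF' hz)) (by simpa using h) |>.imp (by simp)
  have hWmax : ∀ C ∈ F, W ⊆ C → C = W := by
    intro C hC h
    exact (hW.eq_of_ge ⟨hFirr C hC, hF ▸ Set.subset_sUnion_of_mem hC⟩ h)
  -- Otherwise the closed union of the other components would contain the whole closure, hence `W`.
  have : ∃ a ∈ S, (fun x => algebraMap K (AlgebraicClosure K) (a x)) ∉ ⋃₀ (F \ {W}) := by
    by_contra! hcon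
    have hcl : IsClosed (⋃₀ (F \ {W})) :=
      Set.sUnion_eq_biUnion ▸
        (hFfin.subset Set.sdiff_subset).isClosed_biUnion fun C hC => hFcl C hC.1
    obtain ⟨I, hI⟩ := ZariskiSpace.isClosed_iff.1 hcl
    have hsub : zariskiClosure S ⊆ ⋃₀ (F \ {W}) := by
      rw [hI]
      intro w hw g hg
      refine aeval_eq_zero_of_mem_zariskiClosure (fun a ha => ?_) hw
      have := hcon a ha
      rw [hI] at this
      exact this g hg
    obtain ⟨C, hC, hWC⟩ := key W hW.prop.1 (F \ {W}) Set.sdiff_subset (hW.prop.2.trans hsub)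
    exact hC.2 (hWmax C hC.1 hWC)
  obtain ⟨a, ha, haF⟩ := this
  obtain ⟨Y, hY, hYS, haY, hc⟩ := H a ha
  obtain ⟨C, hC, hYC⟩ := key Y hY F subset_rfl (hF ▸ hYS)
  have hCW : C = W := by
    by_contra hne
    exact haF ⟨C, ⟨hC, hne⟩, hYC haY⟩
  subst hCW
  exact (le_iInf₂ fun D hD => iInf₂_le D (hD.trans hYC)).trans hc

/-! ### Functions affine in each argument. -/

/-- Affine dependence on the `j`-th argument. -/
def IsAffineInArg {K : Type*} [Field K] {d : ℕ} {n : Fin d → ℕ}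
    (f : (∀ i, Fin (n i) → K) → K) (j : Fin d) : Prop :=
  ∀ (v : ∀ i, Fin (n i) → K) (y z : Fin (n j) → K),
    f (Function.update v j (y + z)) = f (Function.update v j y) +
      ∑ k, z k * (f (Function.update v j (Pi.single k 1)) - f (Function.update v j 0))

theorem MvPolynomial.IsHomogeneous.exists_eval_eq_sum {K ι : Type*} [Field K] [Fintype ι]
    {p : MvPolynomial ι K} (hp : p.IsHomogeneous 1) :
    ∃ c : ι → K, ∀ x, eval x p = ∑ k, x k * c k := by
  have h : p ∈ homogeneousSubmodule ι K 1 := hp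
  rw [homogeneousSubmodule_one_eq_span_X, Submodule.mem_span_range_iff_exists_fun] at h
  obtain ⟨c, rfl⟩ := h
  exact ⟨c, fun x => by simp [map_sum, smul_eval, mul_comm]⟩

theorem MultidegreeLE.isAffineInArg {K : Type*} [Field K] {d : ℕ} {n : Fin d → ℕ}
    {f : (∀ i, Fin (n i) → K) → K} (hf : MultidegreeLE f (fun _ => 1)) (j : Fin d) :
    IsAffineInArg f j := by
  intro v y z
  obtain ⟨e, he, h⟩ := hf j
  obtain ⟨p, hp, hpv⟩ := h v
  simp only [hpv]
  interval_cases e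
  · rw [totalDegree_eq_zero_iff_eq_C.1 ((totalDegree_zero_iff_isHomogeneous _).2 hp)]
    simp
  · obtain ⟨c, hc⟩ := hp.exists_eval_eq_sum
    simp only [hc]
    simp [add_mul, Finset.sum_add_distrib, Pi.single_apply]

/-- An affine function is interpolated by its values at the origin and the unit vectors; the
induction frees one argument at a time. -/
theorem exists_eval_eq_of_isAffineInArg {K : Type*} [Field K] {d : ℕ} {n : Fin d → ℕ}
    {f : (∀ i, Fin (n i) → K) → K} (hf : ∀ j, IsAffineInArg f j) :
    ∃ F : MvPolynomial (Σ i, Fin (n i)) K, ∀ x, eval x F = f (fun i k => x ⟨i, k⟩) := by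
  suffices h : ∀ (s : Finset (Fin d)) (v : ∀ i, Fin (n i) → K),
      ∃ F : MvPolynomial (Σ i, Fin (n i)) K, ∀ x,
        eval x F = f (fun i => if i ∈ s then fun k => x ⟨i, k⟩ else v i) by
    simpa using h Finset.univ 0
  intro s
  induction s using Finset.induction_on with
  | empty => exact fun v => ⟨C (f v), fun x => by simp⟩
  | insert j s hj ih =>
    intro v
    choose F hF using fun c => ih (Function.update v j c)
    refine ⟨F 0 + ∑ k, X ⟨j, k⟩ * (F (Pi.single k 1) - F 0), fun x => ?_⟩
    have hupd : ∀ c : Fin (n j) → K,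
        (fun i => if i ∈ s then fun k => x ⟨i, k⟩ else Function.update v j c i) =
        Function.update (fun i => if i ∈ s then fun k => x ⟨i, k⟩ else v i) j c := by
      intro c
      funext i
      rcases eq_or_ne i j with rfl | hij
      · simp [hj]
      · simp [hij]
    have hins : (fun i => if i ∈ insert j s then fun k => x ⟨i, k⟩ else v i) =
        Function.update (fun i => if i ∈ s then fun k => x ⟨i, k⟩ else v i) j
          (0 + fun k => x ⟨j, k⟩) := by
      funext i
      rcases eq_or_ne i j with rfl | hij
      · simp
      · simp [hij]
    rw [hins, hf j]
    simp [hF, hupd]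

/-! ### Linear relations over a domain. -/

/-- A family of vectors in `R^μ` over a domain has, for all but `card μ` of its indices `k`, a
linear relation in which `k` is the only one of those indices that occurs. -/
theorem exists_triangular_relations {R ι μ : Type*} [CommRing R] [IsDomain R] [Fintype ι]
    [DecidableEq ι] [Fintype μ] (b : ι → μ → R) :
    ∃ (T : Finset ι) (w : ι → ι → R), Fintype.card ι ≤ T.card + Fintype.card μ ∧
      ∀ k ∈ T, w k k ≠ 0 ∧ (∀ k' ∈ T, k' ≠ k → w k k' = 0) ∧ ∑ k', w k k' • b k' = 0 := by
  classical
  obtain ⟨s, hs, hmax⟩ := exists_maximal_linearIndepOn R b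
  have hcard : s.toFinset.card ≤ Fintype.card μ := by
    have := LinearIndependent.fintype_card_le_finrank hs
    rwa [Module.finrank_fintype_fun_eq_card, ← Set.toFinset_card] at this
  have hrel : ∀ k, ∃ w : ι → R, k ∉ s → w k ≠ 0 ∧ (∀ k' ∉ s, k' ≠ k → w k' = 0) ∧
      ∑ k', w k' • b k' = 0 := by
    intro k
    by_cases hk : k ∈ s
    · exact ⟨0, fun h => absurd hk h⟩
    -- Without division, maximality only puts a nonzero multiple `r • b k` in the span; `r` becomes
    -- the pivot `w k k`.
    obtain ⟨r, hr, hmem⟩ := hmax k hk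
    rw [← s.coe_toFinset, ← Finset.coe_image] at hmem
    obtain ⟨c, hc⟩ : ∃ c : ι → R, ∑ k' ∈ s.toFinset, c k' • b k' = r • b k := by
      rw [Finset.coe_image] at hmem
      obtain ⟨c, hc⟩ := (Submodule.mem_span_image_finset_iff_exists_fun R).1 hmem
      refine ⟨fun k' => if h : k' ∈ s.toFinset then c ⟨k', h⟩ else 0, ?_⟩
      rw [← hc, ← Finset.sum_coe_sort]
      simp
    refine ⟨fun k' => (if k' = k then r else 0) - if k' ∈ s then c k' else 0, fun _ => ⟨?_, ?_, ?_⟩⟩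
    · simpa [hk]
    · intro k' hk' hne
      simp [hk', hne]
    · simp only [sub_smul, ite_smul, zero_smul, Finset.sum_sub_distrib, Finset.sum_ite_eq',
        Finset.mem_univ, if_true, ← hc]
      rw [← Finset.sum_filter, sub_eq_zero]
      congr 1
      ext; simp
  choose w hw using hrel
  refine ⟨s.toFinsetᶜ, w, ?_, fun k hk => ?_⟩
  · rw [Finset.card_compl]; omega
  · simpa using hw k (by simpa using hk)

theorem MvPolynomial.aeval_congr_of_mem_supported {σ K L : Type*} [CommRing K] [CommRing L]
    [Algebra K L] {S : Set σ} {p : MvPolynomial σ K} (hp : p ∈ supported K S) {t t' : σ → L}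
    (h : ∀ x ∈ S, t x = t' x) : aeval t p = aeval t' p := by
  rw [mem_supported] at hp
  exact eval₂Hom_congr' rfl (fun i hi _ => h i (hp hi)) rfl

/-! ### Dominant parametrizations through a rational point. -/

/-- A polynomial parametrization `φ` of a subset of the common zeros of the `f l`, sending the
origin to `a`, varying only in the arguments in `s`, and dominant onto the coordinates in `T`. -/
structure IsDominantParam {K : Type*} (L : Type*) [Field K] [Field L] [Algebra K L] {d m : ℕ}
    {n : Fin d → ℕ} (f : Fin m → (∀ i, Fin (n i) → K) → K) (a : (Σ i, Fin (n i)) → K)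
    (s : Finset (Fin d)) (φ : (Σ i, Fin (n i)) → MvPolynomial (Σ i, Fin (n i)) K)
    (T : Finset (Σ i, Fin (n i))) : Prop where
  eq_C : ∀ x, x.1 ∉ s → φ x = C (a x)
  eval_zero : ∀ x, eval 0 (φ x) = a x
  mem_supported : ∀ x, φ x ∈ supported K {y : Σ i, Fin (n i) | y.1 ∈ s}
  zero : ∀ t l, f l (fun i k => eval t (φ ⟨i, k⟩)) = 0
  fst_mem : ∀ x ∈ T, x.1 ∈ s
  card_le : ∑ i ∈ s, n i ≤ T.card + s.card * m
  -- The free values `u` outside `T` let the induction prescribe the new coordinates first and solve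
  -- for their parameters afterwards.
  dominant : ∀ g : MvPolynomial (Σ i, Fin (n i)) L,
    (∀ t u : (Σ i, Fin (n i)) → L,
      eval (fun x => if x ∈ T then aeval t (φ x) else u x) g = 0) → g = 0

theorem isDominantParam_empty {K L : Type*} [Field K] [Field L] [Infinite L] [Algebra K L]
    {d m : ℕ} {n : Fin d → ℕ} {f : Fin m → (∀ i, Fin (n i) → K) → K}
    {a : (Σ i, Fin (n i)) → K} (ha : a ∈ multilinearVariety f) :
    IsDominantParam L f a ∅ (fun x => C (a x)) ∅ where
  eq_C _ _ := rfl
  eval_zero _ := by simp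
  mem_supported x := (supported K _).algebraMap_mem (a x)
  zero t l := by simpa using ha l
  fst_mem := by simp
  card_le := by simp
  dominant g hg := MvPolynomial.funext fun u => by simpa using hg 0 u

theorem IsDominantParam.exists_insert {K L : Type*} [Field K] [Field L] [Infinite L]
    [Algebra K L] {d m : ℕ} {n : Fin d → ℕ} {f : Fin m → (∀ i, Fin (n i) → K) → K}
    (hf : ∀ l j, IsAffineInArg (f l) j) {a : (Σ i, Fin (n i)) → K} {s : Finset (Fin d)}
    {φ : (Σ i, Fin (n i)) → MvPolynomial (Σ i, Fin (n i)) K} {T : Finset (Σ i, Fin (n i))}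
    (h : IsDominantParam L f a s φ T) {j : Fin d} (hj : j ∉ s) :
    ∃ φ' T', IsDominantParam L f a (insert j s) φ' T' := by
  classical
  choose F hF using fun l => exists_eval_eq_of_isAffineInArg (hf l)
  let R := supported K {y : Σ i, Fin (n i) | y.1 ∈ s}
  -- Working over `R` makes the relations `w` depend only on the old parameters, so the new ones
  -- enter linearly.
  let E : Fin m → (Fin (n j) → K) → R := fun l c =>
    aeval (fun x => Function.update (fun i k => (⟨φ ⟨i, k⟩, h.mem_supported _⟩ : R)) j
      (fun k => algebraMap K R (c k)) x.1 x.2) (F l)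
  have hE : ∀ l c t, eval t (E l c : MvPolynomial _ K) =
      f l (Function.update (fun i k => eval t (φ ⟨i, k⟩)) j c) := by
    intro l c t
    have h1 : eval t (E l c : MvPolynomial _ K) = ((aeval t).comp R.val) (E l c) := by
      simp [aeval_eq_eval]
    rw [h1, ← AlgHom.comp_apply, comp_aeval, aeval_eq_eval, hF]
    congr 1
    funext i k
    rcases eq_or_ne i j with rfl | hij
    · simp
    · simp [hij, aeval_eq_eval]
  obtain ⟨U, w, hU, hw⟩ := exists_triangular_relations
    (fun (k : Fin (n j)) l => E l (Pi.single k 1) - E l 0)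
  let ψ : Fin (n j) → MvPolynomial (Σ i, Fin (n i)) K := fun k' =>
    ∑ k ∈ U, X ⟨j, k⟩ * (w k k' : MvPolynomial _ K)
  let φ' : (Σ i, Fin (n i)) → MvPolynomial (Σ i, Fin (n i)) K := fun x =>
    Function.update (fun i k => φ ⟨i, k⟩) j (fun k' => C (a ⟨j, k'⟩) + ψ k') x.1 x.2
  have hφj : ∀ k, φ' ⟨j, k⟩ = C (a ⟨j, k⟩) + ψ k := fun k => by simp [φ']
  have hφne : ∀ x, x.1 ≠ j → φ' x = φ x := fun x hx => by simp [φ', hx]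
  have hψU : ∀ k ∈ U, ψ k = X ⟨j, k⟩ * (w k k : MvPolynomial _ K) := fun k hk => by
    refine Finset.sum_eq_single k (fun k' hk' hne => ?_) (fun h => absurd hk h)
    rw [(hw k' hk').2.1 k hk hne.symm]
    simp
  have hRle : R ≤ supported K {y : Σ i, Fin (n i) | y.1 ∈ insert j s} :=
    supported_mono fun y hy => Finset.mem_insert_of_mem hy
  have hTj : ∀ x ∈ T, x.1 ≠ j := fun x hx hxj => hj (hxj ▸ h.fst_mem x hx)
  refine ⟨φ', T ∪ U.image (Sigma.mk j), ?_, ?_, ?_, ?_, ?_, ?_, ?_⟩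
  · intro x hx
    rw [Finset.mem_insert, not_or] at hx
    rw [hφne x hx.1, h.eq_C x hx.2]
  · rintro ⟨i, k⟩
    rcases eq_or_ne i j with rfl | hij
    · simp [hφj, ψ]
    · rw [hφne _ hij, h.eval_zero]
  · rintro ⟨i, k⟩
    rcases eq_or_ne i j with rfl | hij
    · rw [hφj]
      refine add_mem (Subalgebra.algebraMap_mem _ _) (sum_mem fun k' _ => mul_mem ?_ ?_)
      · exact X_mem_supported.2 (Finset.mem_insert_self _ _)
      · exact hRle (w k' k).2
    · rw [hφne _ hij]
      exact hRle (h.mem_supported _)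
  · intro t l
    have h1 : (fun i k => eval t (φ' ⟨i, k⟩)) =
        Function.update (fun i k => eval t (φ ⟨i, k⟩)) j
          ((fun k => a ⟨j, k⟩) + fun k => eval t (ψ k)) := by
      funext i k
      rcases eq_or_ne i j with rfl | hij
      · simp [hφj]
      · simp [hφne ⟨i, k⟩ hij, hij]
    have h2 : Function.update (fun i k => eval t (φ ⟨i, k⟩)) j (fun k => a ⟨j, k⟩) =
        fun i k => eval t (φ ⟨i, k⟩) := by
      funext i k
      rcases eq_or_ne i j with rfl | hij
      · simp [h.eq_C ⟨i, k⟩ hj]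
      · simp [hij]
    rw [h1, hf l j, h2, h.zero, zero_add]
    simp only [← hE, ψ, map_sum, map_mul, Finset.sum_mul]
    rw [Finset.sum_comm]
    refine Finset.sum_eq_zero fun k hk => ?_
    have h3 := congrArg (fun r : R => eval t (r : MvPolynomial _ K)) (congrFun (hw k hk).2.2 l)
    simp only [Finset.sum_apply, Pi.smul_apply, smul_eq_mul, Pi.zero_apply] at h3
    rw [AddSubmonoidClass.coe_finsetSum] at h3
    simp only [map_sum, MulMemClass.coe_mul, AddSubgroupClass.coe_sub, map_mul, map_sub,
      ZeroMemClass.coe_zero, map_zero] at h3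
    simp only [mul_assoc, ← Finset.mul_sum, h3, mul_zero]
  · intro x hx
    rcases Finset.mem_union.1 hx with hx | hx
    · exact Finset.mem_insert_of_mem (h.fst_mem x hx)
    · obtain ⟨k, -, rfl⟩ := Finset.mem_image.1 hx
      exact Finset.mem_insert_self _ _
  · have hdisj : Disjoint T (U.image (Sigma.mk j)) := by
      rw [Finset.disjoint_left]
      rintro x hx hxU
      obtain ⟨k, -, rfl⟩ := Finset.mem_image.1 hxU
      exact hTj _ hx rfl
    rw [Finset.card_union_of_disjoint hdisj, Finset.card_image_of_injective _ sigma_mk_injective,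
      Finset.sum_insert hj, Finset.card_insert_of_notMem hj, add_mul, one_mul]
    have := h.card_le
    simp only [Fintype.card_fin] at hU
    omega
  · intro g hg
    refine h.dominant g fun t₀ u => ?_
    let G : MvPolynomial (Σ i, Fin (n i)) L := aeval
      (fun x => if x ∈ T then MvPolynomial.map (algebraMap K L) (φ x) else C (u x)) g
    have hG : ∀ t, eval t G = eval (fun x => if x ∈ T then aeval t (φ x) else u x) g := by
      intro t
      rw [← aeval_eq_eval, ← AlgHom.comp_apply, comp_aeval, aeval_eq_eval]
      congr 2
      funext x
      split_ifs <;> simp [aeval_map_algebraMap]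
    -- Where the product of pivots is nonzero, `t'` solves for the new parameters that hit the
    -- values `u`. Hence `D * G` vanishes everywhere.
    let D : MvPolynomial (Σ i, Fin (n i)) L :=
      ∏ k ∈ U, MvPolynomial.map (algebraMap K L) (w k k : MvPolynomial _ K)
    have hD : D ≠ 0 := by
      refine Finset.prod_ne_zero_iff.2 fun k hk h0 => (hw k hk).1 ?_
      apply Subtype.ext
      exact map_injective _ (algebraMap K L).injective (by simpa using h0)
    have hDG : D * G = 0 := by
      refine MvPolynomial.funext fun t => ?_
      rw [map_mul, map_zero]
      by_cases hDt : eval t D = 0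
      · rw [hDt, zero_mul]
      have hwt : ∀ k ∈ U, aeval t (w k k : MvPolynomial _ K) ≠ 0 := by
        intro k hk h0
        refine hDt ?_
        rw [map_prod]
        refine Finset.prod_eq_zero hk ?_
        rw [← aeval_eq_eval, aeval_map_algebraMap, h0]
      let t' : (Σ i, Fin (n i)) → L := fun x =>
        Function.update (fun i k => t ⟨i, k⟩) j (fun k =>
          (u ⟨j, k⟩ - algebraMap K L (a ⟨j, k⟩)) / aeval t (w k k : MvPolynomial _ K)) x.1 x.2
      have ht' : ∀ p ∈ R, aeval t' p = aeval t p := fun p hp =>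
        aeval_congr_of_mem_supported hp fun x hx => by
          have : x.1 ≠ j := fun hxj => hj (hxj ▸ hx)
          simp [t', this]
      have hpt : (fun x => if x ∈ T ∪ U.image (Sigma.mk j) then aeval t' (φ' x) else u x) =
          fun x => if x ∈ T then aeval t (φ x) else u x := by
        funext x
        by_cases hxT : x ∈ T
        · simp [hxT, hφne x (hTj x hxT), ht' _ (h.mem_supported x)]
        by_cases hxU : x ∈ U.image (Sigma.mk j)
        · rw [if_pos (Finset.mem_union_right _ hxU), if_neg hxT]
          obtain ⟨k, hk, rfl⟩ := Finset.mem_image.1 hxU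
          rw [hφj, hψU k hk, map_add, map_mul, ht' _ (w k k).2, aeval_C, aeval_X]
          simp [t', div_mul_cancel₀ _ (hwt k hk)]
        · rw [if_neg (by simp only [Finset.mem_union, not_or]; exact ⟨hxT, hxU⟩), if_neg hxT]
      rw [hG, ← hpt, hg, mul_zero]
    rw [← hG, (mul_eq_zero.1 hDG).resolve_left hD, map_zero]

theorem exists_isDominantParam {K : Type*} (L : Type*) [Field K] [Field L] [Infinite L]
    [Algebra K L] {d m : ℕ} {n : Fin d → ℕ} {f : Fin m → (∀ i, Fin (n i) → K) → K}
    (hf : ∀ l j, IsAffineInArg (f l) j) {a : (Σ i, Fin (n i)) → K}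
    (ha : a ∈ multilinearVariety f) (s : Finset (Fin d)) :
    ∃ φ T, IsDominantParam L f a s φ T := by
  induction s using Finset.induction_on with
  | empty => exact ⟨_, _, isDominantParam_empty ha⟩
  | insert j s hj ih =>
    obtain ⟨φ, T, h⟩ := ih
    exact h.exists_insert hf hj

/-- The set is the zero locus of the kernel of substitution of `φ`. This kernel is prime, and
dominance says that it contains no nonzero polynomial in the `T`-coordinates. -/
theorem IsDominantParam.exists_isIrreducible {K L : Type*} [Field K] [Infinite K] [Field L]
    [IsAlgClosed L] [Algebra K L] {d m : ℕ} {n : Fin d → ℕ}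
    {f : Fin m → (∀ i, Fin (n i) → K) → K} {a : (Σ i, Fin (n i)) → K}
    {φ : (Σ i, Fin (n i)) → MvPolynomial (Σ i, Fin (n i)) K} {T : Finset (Σ i, Fin (n i))}
    (h : IsDominantParam L f a Finset.univ φ T) :
    ∃ Y : Set (ZariskiSpace (Σ i, Fin (n i)) L), IsIrreducible Y ∧
      Y ⊆ zeroLocus L (vanishingIdeal K (multilinearVariety f)) ∧
      (fun x => algebraMap K L (a x)) ∈ Y ∧ codim Y ≤ (d * m : ℕ) := by
  classical
  let θ : MvPolynomial (Σ i, Fin (n i)) L →ₐ[L] MvPolynomial (Σ i, Fin (n i)) L :=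
    aeval fun x => MvPolynomial.map (algebraMap K L) (φ x)
  have hθ : ∀ t g, eval t (θ g) = eval (fun x => aeval t (φ x)) g := by
    intro t g
    rw [← aeval_eq_eval, ← AlgHom.comp_apply, comp_aeval, aeval_eq_eval]
    simp only [aeval_map_algebraMap]
  let Q := RingHom.ker θ
  have hQ : Q.IsPrime := RingHom.ker_isPrime _
  refine ⟨zeroLocus L Q, ZariskiSpace.isIrreducible_zeroLocus Q, ?_, ?_, ?_⟩
  · intro w hw g hg
    -- Substituting `φ` into `g` gives a polynomial vanishing at all `K`-points, which is zero
    -- because `K` is infinite.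
    have hφ0 : aeval φ g = 0 := by
      refine MvPolynomial.funext fun t => ?_
      rw [map_zero, ← aeval_eq_eval, ← AlgHom.comp_apply, comp_aeval]
      refine hg (fun x => aeval t (φ x)) fun l => ?_
      simpa only [aeval_eq_eval] using h.zero t l
    have hmem : MvPolynomial.map (algebraMap K L) g ∈ Q := by
      have : Infinite L := Infinite.of_injective _ (algebraMap K L).injective
      refine MvPolynomial.funext fun t => ?_
      have h1 := AlgHom.congr_fun (comp_aeval φ (aeval t : _ →ₐ[K] L)) g
      rw [AlgHom.comp_apply, hφ0, map_zero] at h1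
      rw [map_zero, h1]
      change eval t (θ (MvPolynomial.map (algebraMap K L) g)) = _
      rw [hθ, ← aeval_eq_eval, aeval_map_algebraMap]
    exact (aeval_map_algebraMap L (w : _ → L) g).symm.trans (hw _ hmem)
  · intro g hg
    have h0 := congrArg (eval 0) (show θ g = 0 from hg)
    rw [hθ, map_zero] at h0
    rw [aeval_eq_eval, ← h0]
    congr 2
    funext x
    rw [← h.eval_zero x, ← aeval_eq_eval]
    simp
  · refine (ZariskiSpace.codim_zeroLocus_le_height Q).trans ?_
    refine (MvPolynomial.height_le_card_compl Q T fun p hp => ?_).trans ?_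
    · have hren := h.dominant (rename Subtype.val p) fun t u => by
        have h0 := congrArg (eval t) (show θ (rename Subtype.val p) = 0 from hp)
        rw [hθ, map_zero, eval_rename] at h0
        rw [eval_rename, ← h0]
        congr 2
        funext x
        simp
      exact rename_injective _ Subtype.val_injective (by rw [hren, map_zero])
    · have := h.card_le
      rw [Finset.card_univ, Fintype.card_fin] at this
      rw [Finset.card_compl, Fintype.card_sigma]
      simp only [Fintype.card_fin]
      exact_mod_cast (by omega)

theorem mainTheorem9 {K : Type*} [Field K] [Infinite K] {d m : ℕ} (n : Fin d → ℕ)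
    (f : Fin m → (∀ i, Fin (n i) → K) → K)
    (hf : ∀ j, MultidegreeLE (f j) (fun _ => 1))
    (W : Set (ZariskiSpace (Σ i, Fin (n i)) (AlgebraicClosure K)))
    (hW : IsIrreducibleComponentOf W (zariskiClosure (multilinearVariety f))) :
    codim W ≤ (2 ^ d * m : ℕ) := by
  have : Infinite (AlgebraicClosure K) :=
    Infinite.of_injective _ (algebraMap K (AlgebraicClosure K)).injective
  -- The construction gives the sharper bound `d * m`.
  have hdm : d * m ≤ 2 ^ d * m := Nat.mul_le_mul_right m d.lt_two_pow_self.le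
  refine (codim_irreducibleComponent_zariskiClosure_le hW (d * m : ℕ) fun a ha => ?_).trans
    (by exact_mod_cast hdm)
  obtain ⟨φ, T, h⟩ := exists_isDominantParam (AlgebraicClosure K)
    (fun l j => (hf l).isAffineInArg j) ha Finset.univ
  exact h.exists_isIrreducible
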